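/- Let $X$ and $Z$ be real Hausdorff locally convex topological vector spaces, let $L(X,Z)$ be the set of continuous linear operators from $X$ to $Z$, and write $\langle T,x\rangle=T(x)$ for $T\in L(X,Z)$, $x\in X$. Let $C\subseteq Z$ be a convex pointed cone, i.e. $tC\subseteq C$ for all $t\ge 0$, $C+C=C$ and $C\cap(-C)=\{0\}$. Let $K\subseteq X$ be nonempty, convex and compact, and let $D\subseteq K$ be self-segment-dense in $K$, i.e. $K\subseteq\operatorname{cl}D$ and, for all $x,y\in D$, the set $[x,y]\cap D$ is dense in the segment $[x,y]$. A map $f:K\to Z$ is called strongly $C$-upper semicontinuous at $x\in K$ if for every $k\in C\setminus\{0\}$ there is a neighbourhood $U$ of $x$ such that $f(u)\in f(x)+k-(C\setminus\{0\})$ for all $u\in U\cap K$; it is strongly $C$-upper semicontinuous on a subset of $K$ if it is so at each point of that subset. It is called $C$-convex on $D$ if $\sum_{i=1}^n\lambda_i f(x_i)-f\left(\sum_{i=1}^n\lambda_i x_i\right)\in C$ whenever $n\in\mathbb{N}$, $x_1,\dots,x_n\in D$, $\lambda_1,\dots,\lambda_n\ge 0$, $\sum_{i=1}^n\lambda_i=1$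 and $\sum_{i=1}^n\lambda_i x_i\in D$. Let $F:K\to L(X,Z)$ satisfy: (i) for every $y\in D$, the map $x\mapsto\langle F(y),y-x\rangle$ is strongly $C$-upper semicontinuous on $K$; (ii) for every $x\in K$, the map $y\mapsto\langle F(y),y-x\rangle$ is strongly $C$-upper semicontinuous on $K\setminus D$; (iii) for every $x\in D$, the map $y\mapsto\langle F(y),y-x\rangle$ is $C$-convex on $D$. Then there exists $x_0\in K$ such that $\langle F(y),y-x_0\rangle\notin -C\setminus\{0\}$ for all $y\in K$. -/

import Mathlib

open Set Filter Topology
open scoped Pointwise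

/-- `U` is self-segment-dense in the (convex) set `V`: `U ⊆ V`, `U` is dense in `V`, and for all
`x, y ∈ U` the set `[x, y] ∩ U` is dense in the segment `[x, y]`. -/
structure IsSelfSegmentDense {X : Type*} [AddCommGroup X] [Module ℝ X] [TopologicalSpace X]
    (U V : Set X) : Prop where
  subset : U ⊆ V
  dense : V ⊆ closure U
  segment_dense : ∀ x ∈ U, ∀ y ∈ U, segment ℝ x y ⊆ closure (segment ℝ x y ∩ U)

/-- The map `f`, regarded as a map `K → Z`, is strongly `C`-upper semicontinuous at `x`: for every
`k ∈ C \ {0}` there is a neighbourhood `U` of `x` such that `f u ∈ f x + k - (C \ {0})` for all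
`u ∈ U ∩ K`. Only the values of `f` on `K` matter when `x ∈ K`. -/
def StronglyCUpperSemicontinuousAt {X Z : Type*} [TopologicalSpace X] [AddCommGroup Z] [Module ℝ Z]
    (C : PointedCone ℝ Z) (K : Set X) (f : X → Z) (x : X) : Prop :=
  ∀ k ∈ (C : Set Z) \ {0}, ∃ U ∈ 𝓝 x, ∀ u ∈ U ∩ K, f u ∈ {f x + k} - (C : Set Z) \ {0}

/-- `f` is `C`-convex on `D` (not necessarily convex): `f (∑ λᵢ xᵢ) ≤ ∑ λᵢ f (xᵢ)`, where `a ≤ b`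
means `b - a ∈ C`, for all convex combinations of points of `D` that lie in `D`. -/
def IsCConvexOn {X Z : Type*} [AddCommGroup X] [Module ℝ X] [AddCommGroup Z] [Module ℝ Z]
    (C : PointedCone ℝ Z) (D : Set X) (f : X → Z) : Prop :=
  ∀ (n : ℕ) (x : Fin n → X) (l : Fin n → ℝ), (∀ i, x i ∈ D) → (∀ i, 0 ≤ l i) → ∑ i, l i = 1 →
    ∑ i, l i • x i ∈ D → (∑ i, l i • f (x i)) - f (∑ i, l i • x i) ∈ C

/-! ### Positive functionals on a salient cone. -/

section ConeFunctional

variable {Z : Type*} [AddCommGroup Z] [Module ℝ Z]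

/-! For `y ∈ D` the solutions `x ∈ K` form a closed set, so by compactness finitely many `y i ∈ D`
suffice. Strong semicontinuity puts all values `F (y i) (y i - x)` in `interiorDirections`, where
some `φ` is strictly positive on `C \ {0}`. Ville's alternative for the matrix `φ (F (y i) (y i - y
j))` then yields either a solution `∑ j, l j • y j` or weights `m` making every column sum negative.
Density of `D` along segments lets `m` be moved so that `∑ i, m i • y i ∈ D`, where `C`-convexity
gives a contradiction. Points of `K \ D` follow by density of `D`. -/

theorem PointedCone.eq_zero_of_mem_of_neg_mem {C : PointedCone ℝ Z}
    (hC : (C : Set Z) ∩ -(C : Set Z) = {0}) {z : Z} (h : z ∈ C) (h' : -z ∈ C) : z = 0 := by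
  have : z ∈ (C : Set Z) ∩ -(C : Set Z) := ⟨h, h'⟩
  rwa [hC] at this

/-- Adding an element of a salient cone to a nonzero element of the cone gives a nonzero element. -/
theorem PointedCone.add_ne_zero {C : PointedCone ℝ Z}
    (hC : (C : Set Z) ∩ -(C : Set Z) = {0}) {a b : Z} (ha : a ∈ C) (hb : b ∈ C) (ha0 : a ≠ 0) :
    a + b ≠ 0 := fun h =>
  ha0 (PointedCone.eq_zero_of_mem_of_neg_mem hC ha (by rwa [neg_eq_of_add_eq_zero_right h]))

/-- The directions along which every nonzero element of the cone `C` is algebraically interior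
to `C`. -/
def PointedCone.interiorDirections (C : PointedCone ℝ Z) : Submodule ℝ Z where
  carrier := {w | ∀ k ∈ C, k ≠ 0 → (∃ t : ℝ, 0 < t ∧ k + t • w ∈ C) ∧
    ∃ t : ℝ, 0 < t ∧ k - t • w ∈ C}
  zero_mem' := fun k hk _ => ⟨⟨1, one_pos, by simpa⟩, ⟨1, one_pos, by simpa⟩⟩
  add_mem' := by
    have key : ∀ (k w w' : Z) (t t' : ℝ), 0 < t → 0 < t' → k + t • w ∈ C → k + t' • w' ∈ C →
        ∃ s : ℝ, 0 < s ∧ k + s • (w + w') ∈ C := by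
      intro k w w' t t' ht ht' h h'
      -- The weights `t' / (t + t')` and `t / (t + t')` equalise the coefficients of `w` and `w'`.
      refine ⟨t * t' / (t + t'), by positivity, ?_⟩
      have := C.add_mem (C.smul_mem (r := t' / (t + t')) (by positivity) h)
        (C.smul_mem (r := t / (t + t')) (by positivity) h')
      convert this using 1
      have : t + t' ≠ 0 := by positivity
      match_scalars <;> field_simp <;> ring
    intro w w' hw hw' k hk hk0
    obtain ⟨⟨t, ht, h⟩, ⟨s, hs, g⟩⟩ := hw k hk hk0
    obtain ⟨⟨t', ht', h'⟩, ⟨s', hs', g'⟩⟩ := hw' k hk hk0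
    refine ⟨key k w w' t t' ht ht' h h', ?_⟩
    obtain ⟨r, hr, hr'⟩ := key k (-w) (-w') s s' hs hs' (by simpa [sub_eq_add_neg] using g)
      (by simpa [sub_eq_add_neg] using g')
    refine ⟨r, hr, ?_⟩
    convert hr' using 1
    module
  smul_mem' := by
    intro c w hw k hk hk0
    obtain ⟨⟨t, ht, h⟩, ⟨s, hs, g⟩⟩ := hw k hk hk0
    rcases lt_trichotomy c 0 with hc | rfl | hc
    · have hc' := hc.ne
      refine ⟨⟨s / -c, div_pos hs (neg_pos.2 hc), ?_⟩, ⟨t / -c, div_pos ht (neg_pos.2 hc), ?_⟩⟩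
      · convert g using 1
        match_scalars <;> grind
      · convert h using 1
        match_scalars <;> grind
    · exact ⟨⟨1, one_pos, by simpa⟩, ⟨1, one_pos, by simpa⟩⟩
    · refine ⟨⟨t / c, div_pos ht hc, ?_⟩, ⟨s / c, div_pos hs hc, ?_⟩⟩
      · convert h using 1
        match_scalars <;> field_simp
      · convert g using 1
        match_scalars <;> field_simp

/-- A salient cone admits a linear functional which is strictly positive on the nonzero elements
of the cone lying in its space of interior directions. -/
theorem PointedCone.exists_strictlyPositive_functional (C : PointedCone ℝ Z)
    (hC : (C : Set Z) ∩ -(C : Set Z) = {0}) :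
    ∃ φ : Z →ₗ[ℝ] ℝ, ∀ k ∈ C, k ∈ C.interiorDirections → k ≠ 0 → 0 < φ k := by
  by_cases hex : ∃ k ∈ C, k ∈ C.interiorDirections ∧ k ≠ 0
  swap
  · push Not at hex
    exact ⟨0, fun k hk hkW hk0 => absurd (hex k hk hkW) hk0⟩
  obtain ⟨e, he, heW, he0⟩ := hex
  set W := C.interiorDirections with hW
  let e' : W := ⟨e, heW⟩
  have he' : e' ≠ 0 := fun h => he0 (congrArg Subtype.val h)
  let f : W →ₗ.[ℝ] ℝ := LinearPMap.mkSpanSingleton e' (1 : ℝ) he'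
  -- Salience makes `f` nonnegative on the cone in `span e'`; cofinality holds since each `y ∈ W` is
  -- an interior direction at `e`.
  obtain ⟨g, hg, hgC⟩ := riesz_extension (C.comap W.subtype) f (by
      rintro ⟨x, hx⟩ hxC
      obtain ⟨c, rfl⟩ := Submodule.mem_span_singleton.1 hx
      have : f ⟨c • e', hx⟩ = c := by
        have := LinearPMap.mkSpanSingleton'_apply (σ := RingHom.id ℝ) e' (1 : ℝ)
          (fun c hc => by simpa [he'] using hc) c hx
        simpa only [RingHom.id_apply, smul_eq_mul, mul_one] using this
      rw [this]
      by_contra! hc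
      refine he0 (PointedCone.eq_zero_of_mem_of_neg_mem hC he ?_)
      have h1 : c • e ∈ C := hxC
      convert C.smul_mem (r := (-c)⁻¹) (inv_nonneg.2 (by linarith)) h1 using 1
      match_scalars
      grind) (by
      rintro ⟨y, hy⟩
      obtain ⟨t, ht, h⟩ := (hy e he he0).1
      refine ⟨⟨t⁻¹ • e', Submodule.smul_mem _ _ (Submodule.mem_span_singleton_self e')⟩, ?_⟩
      change t⁻¹ • e + y ∈ C
      convert C.smul_mem (r := t⁻¹) (by positivity) h using 1
      match_scalars <;> field_simp)
  have hge : g e' = 1 := by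
    have h1 : e' ∈ f.domain := Submodule.mem_span_singleton_self e'
    rw [hg ⟨e', h1⟩]
    have := LinearPMap.mkSpanSingleton_apply ℝ ℝ (σ := RingHom.id ℝ) he' (1 : ℝ)
    exact this
  obtain ⟨φ, hφ⟩ := g.exists_extend
  refine ⟨φ, fun k hk hkW hk0 => ?_⟩
  have hφg : ∀ w : W, φ w = g w := fun w => by rw [← hφ]; rfl
  -- Strictness: `k - t • e ∈ C` forces `φ k ≥ t * φ e = t > 0`.
  obtain ⟨t, ht, h⟩ := (heW k hk hk0).2
  have h1 : 0 ≤ g (⟨k, hkW⟩ - t • e') := hgC _ h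
  rw [map_sub, map_smul, hge, smul_eq_mul, mul_one] at h1
  have := hφg ⟨k, hkW⟩
  simp only at this
  linarith

end ConeFunctional

/-! ### A theorem of the alternative for matrices. -/

section Minimax

/-- Ville's theorem of the alternative. -/
theorem exists_stdSimplex_nonneg_or_neg {ι κ : Type*} [Fintype ι] [Fintype κ] [Nonempty κ]
    (B : ι → κ → ℝ) :
    (∃ l ∈ stdSimplex ℝ κ, ∀ i, 0 ≤ ∑ j, l j * B i j) ∨
      ∃ m ∈ stdSimplex ℝ ι, ∀ j, ∑ i, m i * B i j < 0 := by
  classical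
  let L : (κ → ℝ) →ₗ[ℝ] (ι → ℝ) := Matrix.mulVecLin (Matrix.of B)
  have hL : ∀ l i, L l i = ∑ j, l j * B i j := fun l i => by
    simp [L, Matrix.mulVec, dotProduct, mul_comm]
  by_cases hdisj : Disjoint (L '' stdSimplex ℝ κ) (Set.Ici 0)
  swap
  · obtain ⟨_, ⟨l, hl, rfl⟩, h⟩ := Set.not_disjoint_iff.1 hdisj
    exact Or.inl ⟨l, hl, fun i => by rw [← hL]; exact h i⟩
  right
  obtain ⟨f, u, v, hu, huv, hv⟩ := geometric_hahn_banach_compact_closed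
    ((convex_stdSimplex ℝ κ).linear_image L)
    ((isCompact_stdSimplex ℝ κ).image L.continuous_of_finiteDimensional)
    (convex_Ici 0) isClosed_Ici hdisj
  have hv0 : v < 0 := by simpa using hv 0 (Set.mem_Ici.2 le_rfl)
  let c : ι → ℝ := fun i => f (Pi.single i 1)
  have hf : ∀ z : ι → ℝ, f z = ∑ i, c i * z i := fun z => by
    conv_lhs => rw [pi_eq_sum_univ' z]
    simp [c, mul_comm]
  have hc : ∀ i, 0 ≤ c i := fun i => by
    by_contra! hci
    -- At this point of the orthant `f` would equal `v`, not exceed it.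
    have := hv ((v / c i) • Pi.single i 1)
      (Set.mem_Ici.2 <| smul_nonneg (div_nonneg_of_nonpos hv0.le hci.le) (Pi.single_nonneg.2 zero_le_one))
    rw [map_smul, smul_eq_mul, div_mul_cancel₀ _ hci.ne] at this
    exact lt_irrefl _ this
  have hneg : ∀ j, ∑ i, c i * B i j < 0 := fun j => by
    have := hu (L (Pi.single j 1)) ⟨_, single_mem_stdSimplex ℝ j, rfl⟩
    rw [hf] at this
    simp only [hL, Pi.single_apply, ite_mul, one_mul, zero_mul, Finset.sum_ite_eq',
      Finset.mem_univ, if_true] at this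
    linarith
  have hpos : 0 < ∑ i, c i := by
    refine lt_of_le_of_ne (Finset.sum_nonneg fun i _ => hc i) fun h => ?_
    have h0 := (Finset.sum_eq_zero_iff_of_nonneg fun i _ => hc i).1 h.symm
    obtain ⟨j⟩ := ‹Nonempty κ›
    have := hneg j
    rw [Finset.sum_eq_zero fun i hi => by rw [h0 i hi, zero_mul]] at this
    exact lt_irrefl _ this
  refine ⟨fun i => c i / ∑ i, c i, ⟨fun i => div_nonneg (hc i) hpos.le, ?_⟩, fun j => ?_⟩
  · rw [← Finset.sum_div, div_self hpos.ne']
  · simp_rw [div_mul_eq_mul_div]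
    rw [← Finset.sum_div]
    exact div_neg_of_neg_of_pos (hneg j) hpos

end Minimax

/-! ### Density of admissible weights. -/

section SegmentDense

/-- If every segment between points of `E` lies in the closure of `E`, then the closure of `E` is
convex. -/
theorem convex_closure_of_segment_subset {V : Type*} [AddCommGroup V] [Module ℝ V]
    [TopologicalSpace V] [IsTopologicalAddGroup V] [ContinuousSMul ℝ V] {E : Set V}
    (h : ∀ a ∈ E, ∀ b ∈ E, segment ℝ a b ⊆ closure E) : Convex ℝ (closure E) := by
  intro x hx y hy s t hs ht hst
  have := map_mem_closure₂ (f := fun a b : V => s • a + t • b) (by fun_prop) hx hy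
    (u := closure E) (fun a ha b hb => h a ha b hb ⟨s, t, hs, ht, hst, rfl⟩)
  rwa [closure_closure] at this

variable {X : Type*} [AddCommGroup X] [Module ℝ X] [TopologicalSpace X] [IsTopologicalAddGroup X]
  [ContinuousSMul ℝ X] [LocallyConvexSpace ℝ X] [T2Space X]

/-- The weights whose convex combination of given points of a self-segment-dense set `D` lies
in `D` are dense in the standard simplex. -/
theorem IsSelfSegmentDense.stdSimplex_subset_closure {D K : Set X} (hD : IsSelfSegmentDense D K)
    {ι : Type*} [Fintype ι] (y : ι → X) (hy : ∀ i, y i ∈ D) :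
    stdSimplex ℝ ι ⊆ closure {m ∈ stdSimplex ℝ ι | ∑ i, m i • y i ∈ D} := by
  classical
  set E := {m ∈ stdSimplex ℝ ι | ∑ i, m i • y i ∈ D} with hE
  have hcomb : ∀ (a b : ι → ℝ) (s t : ℝ), ∑ i, (s • a + t • b) i • y i =
      s • ∑ i, a i • y i + t • ∑ i, b i • y i := fun a b s t => by
    simp [Finset.smul_sum, add_smul, mul_smul, Finset.sum_add_distrib]
  have hseg : ∀ a ∈ E, ∀ b ∈ E, segment ℝ a b ⊆ closure E := by
    rintro a ⟨ha, haD⟩ b ⟨hb, hbD⟩ _ ⟨s, t, hs, ht, hst, rfl⟩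
    by_cases hpq : ∑ i, a i • y i = ∑ i, b i • y i
    · refine subset_closure ⟨convex_stdSimplex ℝ ι ha hb hs ht hst, ?_⟩
      rw [hcomb, ← hpq, ← add_smul, hst, one_smul]
      exact haD
    obtain ⟨f, hf⟩ := geometric_hahn_banach_point_point hpq
    set p := ∑ i, a i • y i
    set q := ∑ i, b i • y i
    have hne : f q - f p ≠ 0 := by linarith
    -- A continuous coordinate along `[p, q]`: it pulls points of `[p, q] ∩ D` back to weights
    -- between `a` and `b`.
    let g : X → ℝ := fun z => (f z - f p) / (f q - f p)
    have hg : ∀ s t : ℝ, s + t = 1 → g (s • p + t • q) = t := fun s t hst => by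
      have : s = 1 - t := by linarith
      subst this
      simp only [g, map_add, map_smul, smul_eq_mul]
      field_simp
      ring
    have hcont : Continuous fun z : X => (1 - g z) • a + g z • b := by
      fun_prop
    have hmem := hD.segment_dense p haD q hbD (show s • p + t • q ∈ segment ℝ p q from
      ⟨s, t, hs, ht, hst, rfl⟩)
    have := map_mem_closure hcont hmem (t := E) (by
      rintro _ ⟨⟨s', t', hs', ht', hst', rfl⟩, hz⟩
      have h1 : 1 - t' = s' := by linarith
      simp only [hg s' t' hst', h1]
      exact ⟨convex_stdSimplex ℝ ι ha hb hs' ht' hst', by rwa [hcomb]⟩)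
    have h1 : 1 - t = s := by linarith
    simpa only [hg s t hst, h1] using this
  rw [← convexHull_rangle_single_eq_stdSimplex]
  refine convexHull_min ?_ (convex_closure_of_segment_subset hseg)
  rintro _ ⟨i, rfl⟩
  refine subset_closure ⟨single_mem_stdSimplex ℝ i, ?_⟩
  simpa [Pi.single_apply, ite_smul] using hy i

end SegmentDense

/-- If `f` is strongly `C`-upper semicontinuous at `x` and `f x ∈ -C \ {0}`, then `f` takes values
in `-C \ {0}` near `x`. -/
theorem StronglyCUpperSemicontinuousAt.exists_nhds_mem_neg
    {X Z : Type*} [TopologicalSpace X] [AddCommGroup Z] [Module ℝ Z] {C : PointedCone ℝ Z}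
    {K : Set X} {f : X → Z} {x : X} (h : StronglyCUpperSemicontinuousAt C K f x)
    (hx : f x ∈ -(C : Set Z) \ {0}) : ∃ U ∈ 𝓝 x, ∀ u ∈ U ∩ K, f u ∈ -(C : Set Z) \ {0} := by
  -- With `k = -f x`, the bound `f x + k` is `0`.
  obtain ⟨U, hU, hUK⟩ := h (-f x) ⟨hx.1, neg_ne_zero.2 hx.2⟩
  refine ⟨U, hU, fun u hu => ?_⟩
  obtain ⟨_, rfl, c, hc, hce⟩ := hUK u hu
  have : f u = -c := by rw [← hce]; simp
  rw [this]
  exact ⟨by simpa using hc.1, neg_ne_zero.2 hc.2⟩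

/-! ### Finite systems of Minty inequalities. -/

section MintyInequality

variable {X : Type*} [AddCommGroup X] [Module ℝ X] [TopologicalSpace X] [IsTopologicalAddGroup X]
  [ContinuousSMul ℝ X]
  {Z : Type*} [AddCommGroup Z] [Module ℝ Z]

/-- Strong upper semicontinuity of `x ↦ T (y - x)` on a convex set makes all differences
`T (v - u)` interior directions of the cone. -/
theorem apply_sub_mem_interiorDirections {C : PointedCone ℝ Z} {K : Set X} (hK : Convex ℝ K)
    (T : X →ₗ[ℝ] Z) (y : X)
    (h : ∀ x ∈ K, StronglyCUpperSemicontinuousAt C K (fun x' => T (y - x')) x)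
    {u v : X} (hu : u ∈ K) (hv : v ∈ K) : T (v - u) ∈ C.interiorDirections := by
  have key : ∀ k ∈ C, k ≠ 0 → ∀ a ∈ K, ∀ b ∈ K, ∃ t : ℝ, 0 < t ∧ k + t • T (b - a) ∈ C := by
    intro k hk hk0 a ha b hb
    obtain ⟨U, hU, hUK⟩ := h a ha k ⟨hk, hk0⟩
    have hlim : Tendsto (fun t : ℝ => a + t • (b - a)) (𝓝 0) (𝓝 a) := by
      have : Continuous fun t : ℝ => a + t • (b - a) := by fun_prop
      simpa using this.tendsto 0
    have hev : ∀ᶠ t : ℝ in 𝓝[>] 0, t ∈ Ioo (0 : ℝ) 1 ∧ a + t • (b - a) ∈ U :=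
      (show ∀ᶠ t : ℝ in 𝓝[>] 0, t ∈ Ioo (0 : ℝ) 1 from Ioo_mem_nhdsGT one_pos).and ((hlim.mono_left nhdsWithin_le_nhds) hU)
    obtain ⟨t, ⟨ht0, ht1⟩, htU⟩ := hev.exists
    obtain ⟨_, rfl, c, hc, hce⟩ := hUK _
      ⟨htU, hK.add_smul_sub_mem ha hb ⟨ht0.le, ht1.le⟩⟩
    refine ⟨t, ht0, ?_⟩
    have hc' : T (y - a) + k - c = T (y - (a + t • (b - a))) := hce
    have : k + t • T (b - a) = c := by
      rw [eq_comm, ← sub_eq_zero, ← sub_eq_zero.2 hc'.symm]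
      simp only [map_sub, map_add, map_smul]
      module
    rw [this]
    exact hc.1
  intro k hk hk0
  refine ⟨key k hk hk0 u hu v hv, ?_⟩
  obtain ⟨t, ht, h⟩ := key k hk hk0 v hv u hu
  refine ⟨t, ht, ?_⟩
  convert h using 1
  rw [← neg_sub v u, map_neg]
  module

/-- Finitely many Minty inequalities at points of `D` have a common solution. -/
theorem exists_forall_notMem_neg_of_finite [LocallyConvexSpace ℝ X] [T2Space X]
    {C : PointedCone ℝ Z} (hC : (C : Set Z) ∩ -(C : Set Z) = {0})
    {K : Set X} (hKne : K.Nonempty) (hKconv : Convex ℝ K)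
    {D : Set X} (hD : IsSelfSegmentDense D K) (F : X → (X →ₗ[ℝ] Z))
    (h_usc : ∀ y ∈ D, ∀ x ∈ K, StronglyCUpperSemicontinuousAt C K (fun x' => F y (y - x')) x)
    (h_convex : ∀ x ∈ D, IsCConvexOn C D (fun y => F y (y - x)))
    {n : ℕ} (y : Fin n → X) (hy : ∀ i, y i ∈ D) :
    ∃ x ∈ K, ∀ i, F (y i) (y i - x) ∉ -(C : Set Z) \ {0} := by
  rcases isEmpty_or_nonempty (Fin n) with hn | hn
  · exact ⟨hKne.some, hKne.some_mem, fun i => hn.elim i⟩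
  obtain ⟨φ, hφ⟩ := C.exists_strictlyPositive_functional hC
  have hW : ∀ i, ∀ x ∈ K, F (y i) (y i - x) ∈ C.interiorDirections := fun i x hx =>
    apply_sub_mem_interiorDirections hKconv (F (y i)) (y i) (h_usc _ (hy i)) hx (hD.subset (hy i))
  have hsum : ∀ l ∈ stdSimplex ℝ (Fin n), ∀ i,
      ∑ j, l j * φ (F (y i) (y i - y j)) = φ (F (y i) (y i - ∑ j, l j • y j)) := by
    intro l hl i
    have : y i - ∑ j, l j • y j = ∑ j, l j • (y i - y j) := by
      simp_rw [smul_sub, Finset.sum_sub_distrib]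
      rw [← Finset.sum_smul, hl.2, one_smul]
    rw [this]
    simp only [map_sum, map_smul, smul_eq_mul]
  have hmemK : ∀ l ∈ stdSimplex ℝ (Fin n), ∑ j, l j • y j ∈ K := fun l hl =>
    hKconv.sum_mem (fun i _ => hl.1 i) hl.2 fun i _ => hD.subset (hy i)
  rcases exists_stdSimplex_nonneg_or_neg fun i j => φ (F (y i) (y i - y j)) with
    ⟨l, hl, h⟩ | ⟨m, hm, h⟩
  · refine ⟨_, hmemK l hl, fun i hi => ?_⟩
    have h1 := h i
    rw [hsum l hl] at h1
    have h2 := hφ _ hi.1 (neg_mem (hW i _ (hmemK l hl))) (neg_ne_zero.2 hi.2)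
    rw [map_neg] at h2
    linarith
  · exfalso
    -- The strict inequalities survive a small move of `m` to admissible weights `m'`.
    have hopen : IsOpen {m : Fin n → ℝ | ∀ j, ∑ i, m i * φ (F (y i) (y i - y j)) < 0} := by
      simp only [ofPred_forall]
      exact isOpen_iInter_of_finite fun j => isOpen_lt (by fun_prop) continuous_const
    obtain ⟨m', hm'neg, hm', hm'D⟩ :=
      mem_closure_iff.1 (hD.stdSimplex_subset_closure y hy hm) _ hopen h
    -- The base point is the combination itself, so the subtracted term is `F x (x - x) = 0`.
    have hCm := h_convex _ hm'D n y m' hy hm'.1 hm'.2 hm'D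
    simp only [sub_self, map_zero, sub_zero] at hCm
    have hnonneg : 0 ≤ φ (∑ i, m' i • F (y i) (y i - ∑ j, m' j • y j)) := by
      by_cases h0 : ∑ i, m' i • F (y i) (y i - ∑ j, m' j • y j) = 0
      · rw [h0, map_zero]
      · exact (hφ _ hCm (Submodule.sum_mem _ fun i _ =>
          Submodule.smul_mem _ _ (hW i _ (hmemK m' hm'))) h0).le
    rw [map_sum] at hnonneg
    simp only [map_smul, smul_eq_mul, ← hsum m' hm', Finset.mul_sum] at hnonneg
    rw [Finset.sum_comm] at hnonneg
    obtain ⟨j, -, hj⟩ : ∃ j ∈ Finset.univ, m' j ≠ 0 :=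
      Finset.exists_ne_zero_of_sum_ne_zero (by rw [hm'.2]; exact one_ne_zero)
    refine absurd hnonneg (not_le.2 ?_)
    have hrw : ∀ j, ∑ i, m' i * (m' j * φ (F (y i) (y i - y j))) =
        m' j * ∑ i, m' i * φ (F (y i) (y i - y j)) := fun j => by
      rw [Finset.mul_sum]
      exact Finset.sum_congr rfl fun i _ => by ring
    simp only [hrw]
    exact Finset.sum_neg' (fun j _ => mul_nonpos_of_nonneg_of_nonpos (hm'.1 j) (hm'neg j).le)
      ⟨j, Finset.mem_univ j,
        mul_neg_of_pos_of_neg (lt_of_le_of_ne (hm'.1 j) hj.symm) (hm'neg j)⟩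

end MintyInequality

/-! ### Compactness, then passage from `D` to `K`. -/

theorem mainTheorem12
    {X : Type*} [AddCommGroup X] [Module ℝ X] [TopologicalSpace X] [IsTopologicalAddGroup X]
    [ContinuousSMul ℝ X] [LocallyConvexSpace ℝ X] [T2Space X]
    {Z : Type*} [AddCommGroup Z] [Module ℝ Z] [TopologicalSpace Z] [IsTopologicalAddGroup Z]
    [ContinuousSMul ℝ Z] [LocallyConvexSpace ℝ Z] [T2Space Z]
    (C : PointedCone ℝ Z) (hC : (C : Set Z) ∩ -(C : Set Z) = {0})
    (K : Set X) (hKne : K.Nonempty) (hKconv : Convex ℝ K) (hKcomp : IsCompact K)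
    (D : Set X) (hD : IsSelfSegmentDense D K)
    -- only the values of `F` on `K` enter the hypotheses and the conclusion
    (F : X → (X →L[ℝ] Z))
    (h_usc_left : ∀ y ∈ D, ∀ x ∈ K,
      StronglyCUpperSemicontinuousAt C K (fun x' => F y (y - x')) x)
    (h_usc_right : ∀ x ∈ K, ∀ y ∈ K \ D,
      StronglyCUpperSemicontinuousAt C K (fun y' => F y' (y' - x)) y)
    (h_convex : ∀ x ∈ D, IsCConvexOn C D (fun y => F y (y - x))) :
    ∃ x₀ ∈ K, ∀ y ∈ K, F y (y - x₀) ∉ -(C : Set Z) \ {0} := by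
  let G : D → Set X := fun y => {x ∈ K | F y (y - x) ∉ -(C : Set Z) \ {0}}
  have hGclosed : ∀ y, IsClosed (G y) := by
    rintro ⟨y, hy⟩
    rw [← isOpen_compl_iff, isOpen_iff_mem_nhds]
    intro x hx
    by_cases hxK : x ∈ K
    · have hx' : F y (y - x) ∈ -(C : Set Z) \ {0} := by
        by_contra h
        exact hx ⟨hxK, h⟩
      obtain ⟨U, hU, hUK⟩ := (h_usc_left y hy x hxK).exists_nhds_mem_neg hx'
      exact mem_of_superset hU fun u hu hG => hG.2 (hUK u ⟨hu, hG.1⟩)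
    · exact mem_of_superset (hKcomp.isClosed.isOpen_compl.mem_nhds hxK) fun u hu hG => hu hG.1
  obtain ⟨x₀, hx₀K, hx₀⟩ := hKcomp.inter_iInter_nonempty G hGclosed fun s => by
    obtain ⟨x, hxK, hx⟩ := exists_forall_notMem_neg_of_finite hC hKne hKconv hD
      (fun y => (F y : X →ₗ[ℝ] Z)) h_usc_left h_convex (n := s.card)
      (fun i => ((s.equivFin.symm i : D) : X)) fun i => (s.equivFin.symm i : D).2
    refine ⟨x, hxK, mem_iInter₂.2 fun y hy => ⟨hxK, ?_⟩⟩
    simpa using hx (s.equivFin ⟨y, hy⟩)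
  rw [mem_iInter] at hx₀
  refine ⟨x₀, hx₀K, fun y hy hmem => ?_⟩
  by_cases hyD : y ∈ D
  · exact (hx₀ ⟨y, hyD⟩).2 hmem
  -- A violation at `y ∉ D` would persist at nearby points of `D`.
  · obtain ⟨U, hU, hUK⟩ :=
      (h_usc_right x₀ hx₀K y ⟨hy, hyD⟩).exists_nhds_mem_neg (f := fun y' => F y' (y' - x₀)) hmem
    obtain ⟨d, hdU, hdD⟩ := mem_closure_iff_nhds.1 (hD.dense hy) U hU
    exact (hx₀ ⟨d, hdD⟩).2 (hUK d ⟨hdU, hD.subset hdD⟩)
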